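/- **Corollary (Scaling regimes).** Let $I$ be a finite index set and let $\gamma_i\neq 0$ ($i\in I$) be real numbers, the intrinsic overlaps; put $\tau_0=\sum_{i\in I}\gamma_i^2$ (the irreducible tax). For every dimension $d\ge 1$ let $v^*=v^*(d)$ (the safety direction) and $a_i=a_i(d)$, $i\in I$ (the capability directions with intrinsic overlap), be unit vectors in $\mathbb{R}^d$, and let $c_1,\dots,c_{m'}$, $m'=m'(d)$ (the incidental capability directions), be independent random vectors, uniformly distributed on the unit sphere $\mathbb{S}^{d-1}$. Let $$\varepsilon(d)=\max\Big(\max_{i\in I}\big|\langle v^*,a_i\rangle-\gamma_i\big|,\ \max_{i\ne j\in I}|\langle a_i,a_j\rangle|\Big)$$ be the packing residual of the intrinsic features (a maximum over an empty set is $0$), and assume $\varepsilon(d)\to 0$ as $d\to\infty$, i.e. the $\gamma_i$ are the limiting overlaps and distinct intrinsic capabilities are asymptotically orthogonal. Let $\tau=\tau(d)=\|P_C v^*\|^2$, where $P_C$ is the orthogonal projection onto the span $C$ of all $a_i$ and $c_j$ (the alignment tax rate). Say that $\tau\to\tau_0$ *at rate $O(r(d))$ with high probability* if $r(d)\to 0$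 and for every $A>0$ there is $K>0$ such that $\Pr(|\tau-\tau_0|>K\,r(d))\le d^{-A}$ for all sufficiently large $d$. Then: 1. (Fixed capabilities.) If $m'$ is constant (for large $d$), then $\tau\to\tau_0$ at rate $O(\log d/d+\varepsilon(d))$ with high probability; in particular at rate $O(\log d/d)$ if $\varepsilon(d)=O(\log d/d)$, for instance if the intrinsic overlaps are attained exactly. 2. (Sublinear growth.) If $m'=O(d^\beta)$ for a real $\beta<1$ (in particular if $0\le\beta<1$ and $m'=d^\beta$ up to rounding), then $\tau\to\tau_0$ at rate $O(\log d/d^{1-\beta}+\varepsilon(d))$ with high probability; in particular at rate $O(\log d/d^{1-\beta})$ if $\varepsilon(d)=O(\log d/d^{1-\beta})$. 3. (Linear growth.) If $m'=\Theta(d)$ and $\tau_0<1$, then $\mathbb{E}[\tau-\tau_0]=\Theta(1)$: there are constants $0<k\le K$ such that for all sufficiently large $d$ the variable $\tau$ is integrable and $k\le\mathbb{E}[\tau-\tau_0]\le K$. So scaling does not remove the incidental tax. -/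

import Mathlib

open MeasureTheory ProbabilityTheory Filter Topology Asymptotics

/-- Representation space `ℝ^d` with its Euclidean norm. -/
abbrev RepSpace (d : ℕ) : Type := EuclideanSpace ℝ (Fin d)

/-- The alignment tax rate `τ = ‖P_C v‖²`, where `C` is the span of the capability directions. -/
noncomputable def taxRate {d : ℕ} {κ : Type*} [Finite κ] (v : RepSpace d) (c : κ → RepSpace d) : ℝ :=
  ‖(Submodule.span ℝ (Set.range c)).starProjection v‖ ^ 2

/-- The irreducible tax `τ₀ = ∑_{i ∈ I} γ_i²`. -/
def irreducibleTax {ι : Type*} [Fintype ι] (γ : ι → ℝ) : ℝ := ∑ i, γ i ^ 2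

/-- The packing residual of a pair of features whose intrinsic overlap is `g`. -/
noncomputable def packingResidual {d : ℕ} (x y : RepSpace d) (g : ℝ) : ℝ := inner ℝ x y - g

/-- The largest packing residual (in absolute value) among the features `v` and `a i`, `i ∈ I`:
the pair `(v, a i)` has intrinsic overlap `γ i`, two distinct capabilities have intrinsic
overlap `0`. (A supremum over an empty index set is `0`.) -/
noncomputable def intrinsicResidual {d : ℕ} {ι : Type*} (v : RepSpace d) (a : ι → RepSpace d)
    (γ : ι → ℝ) : ℝ :=
  max (⨆ i, |packingResidual v (a i) (γ i)|)
    (⨆ p : {p : ι × ι // p.1 ≠ p.2}, |packingResidual (a p.1.1) (a p.1.2) 0|)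

/-- The uniform distribution on the unit sphere of `ℝ^d` (for `d ≥ 1`): the normalized surface
measure, seen as a measure on `ℝ^d`. -/
noncomputable def uniformSphere (d : ℕ) : Measure (RepSpace d) :=
  (((volume : Measure (RepSpace d)).toSphere Set.univ)⁻¹ • (volume : Measure (RepSpace d)).toSphere).map
    Subtype.val

/-- The random packing model in dimension `d`: the safety direction `v` and the capability
directions `a i` with intrinsic overlap are unit vectors, and the incidental capability
directions `c 0, …, c (m' - 1)` are independent and uniform on the unit sphere. -/
structure IsRandomPacking {d m' : ℕ} {ι Ω : Type*} [MeasurableSpace Ω] (P : Measure Ω)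
    (v : RepSpace d) (a : ι → RepSpace d) (c : Fin m' → Ω → RepSpace d) : Prop where
  norm_v : ‖v‖ = 1
  norm_a : ∀ i, ‖a i‖ = 1
  uniform : ∀ j, HasLaw (c j) (uniformSphere d) P
  indep : iIndepFun c P

/-- The random tax rate in the random packing model: all the capability directions, those with
intrinsic overlap and the incidental ones, span the capability subspace. -/
noncomputable def packingTax {d m' : ℕ} {ι Ω : Type*} [Finite ι] (v : RepSpace d) (a : ι → RepSpace d)
    (c : Fin m' → Ω → RepSpace d) (ω : Ω) : ℝ :=
  taxRate v (Sum.elim a fun j => c j ω)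

/-- `X_d → x` at rate `O(r(d))` with high probability: `r(d) → 0`, and for every exponent `A`
there is a constant `K` such that `|X_d - x| ≤ K r(d)` fails with probability at most `d^{-A}`
for all large `d`. -/
def TendstoAtRateWHP {Ω : ℕ → Type*} [∀ d, MeasurableSpace (Ω d)] (P : ∀ d, Measure (Ω d))
    (X : ∀ d, Ω d → ℝ) (x : ℝ) (r : ℕ → ℝ) : Prop :=
  Tendsto r atTop (𝓝 0) ∧
    ∀ A : ℝ, 0 < A → ∃ K : ℝ, 0 < K ∧ ∀ᶠ d : ℕ in atTop,
      (P d).real {ω | K * r d < |X d ω - x|} ≤ (d : ℝ) ^ (-A)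

/-! Let `S` be the span of the intrinsic directions, and split `τ - τ₀` into a deterministic error
`projSq v S - τ₀` and a random gain `τ - projSq v S`. The Gram matrix of the `a i` is the identity
up to entries of size `ε`, so the deterministic error is `O(ε)` (`abs_projSq_span_sub_le`).

For the gain, add the random directions one at a time. By `projSq_sup_span_sub`, adding `c` to a
subspace with projection `Q` raises the squared projection of `v` by `⟪v - Q v, c⟫² / ‖c - Q c‖²`
when `c` lies outside the subspace. For uniform `c` a squared inner product with a vector of norm at
most one exceeds `r` with probability at most `2 exp(-r d / 2)`, and the denominator is at least
`1/2` when dimension times `r` is at most `1/2`. Taking `r` of order `log d / d` makes all failures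
polynomially rare; `m'` gains of at most `2 r` sum to `O(log d / d^(1-β))`. The case of fixed `m'`
is `β = 0`.

For linear growth the denominator is at most one, so the mean gain of a step is at least `(1 -
projSq v S) / d` for the current subspace `S`. Hence the mean of `1 - τ` carries a factor `(1 -
1/d)^m'`, which stays below a constant less than one. -/

/-! ### Squared projections and their increments. -/

section Projection

variable {E : Type*} [NormedAddCommGroup E] [InnerProductSpace ℝ E] [FiniteDimensional ℝ E]

/-- The squared norm of the orthogonal projection of `v` to `S`. -/
noncomputable def projSq (v : E) (S : Submodule ℝ E) : ℝ := ‖S.starProjection v‖ ^ 2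

lemma projSq_nonneg (v : E) (S : Submodule ℝ E) : 0 ≤ projSq v S := sq_nonneg _

lemma projSq_add_norm_sub_sq (v : E) (S : Submodule ℝ E) :
    projSq v S + ‖v - S.starProjection v‖ ^ 2 = ‖v‖ ^ 2 := by
  rw [projSq, S.norm_sq_eq_add_norm_sq_starProjection v]
  simp [Submodule.starProjection_orthogonal']

lemma projSq_le (v : E) (S : Submodule ℝ E) : projSq v S ≤ ‖v‖ ^ 2 := by
  have := projSq_add_norm_sub_sq v S
  nlinarith [sq_nonneg ‖v - S.starProjection v‖]

lemma projSq_eq_inner (v : E) (S : Submodule ℝ E) :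
    projSq v S = inner ℝ v (S.starProjection v) := by
  have h := Submodule.starProjection_inner_eq_zero (K := S) v _ (S.starProjection_apply_mem v)
  rw [inner_sub_left, real_inner_self_eq_norm_sq] at h
  rw [projSq]; linarith

/-- The increment of the squared projection when a single vector is added to the subspace. -/
lemma projSq_sup_span_sub (v c : E) (S : Submodule ℝ E) :
    (projSq v (S ⊔ ℝ ∙ c) - projSq v S) * ‖c - S.starProjection c‖ ^ 2
      = inner ℝ (v - S.starProjection v) c ^ 2 := by
  set S' := S ⊔ ℝ ∙ c with hS'
  set p := S'.starProjection v with hp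
  set q := S.starProjection v with hq
  set x := c - S.starProjection c with hx
  have hSS' : S ≤ S' := le_sup_left
  have hc : c ∈ S' := le_sup_right (a := S) (Submodule.mem_span_singleton_self c)
  have hpS' : p ∈ S' := S'.starProjection_apply_mem v
  have hqS : q ∈ S := S.starProjection_apply_mem v
  have ox : ∀ s ∈ S, inner ℝ x s = 0 := fun s hs =>
    Submodule.starProjection_inner_eq_zero (K := S) c s hs
  have oq : ∀ s ∈ S, inner ℝ (v - q) s = 0 := fun s hs =>
    Submodule.starProjection_inner_eq_zero (K := S) v s hs
  have op : ∀ s ∈ S', inner ℝ (v - p) s = 0 := fun s hs =>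
    Submodule.starProjection_inner_eq_zero (K := S') v s hs
  have opq : ∀ s ∈ S, inner ℝ (p - q) s = 0 := fun s hs => by
    have h1 := oq s hs
    have h2 := op s (hSS' hs)
    simp only [inner_sub_left] at h1 h2 ⊢; linarith
  -- Both `p - q` and `x` are orthogonal to `S`, and for the right `lam` the difference `p - q - lam
  -- • x` lies in `S`; being orthogonal to itself, it vanishes.
  obtain ⟨lam, hlam⟩ : ∃ lam : ℝ, p - q = lam • x := by
    obtain ⟨s, hs, y, hy, hsy⟩ := Submodule.mem_sup.1 (S'.sub_mem hpS' (hSS' hqS))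
    obtain ⟨lam, rfl⟩ := Submodule.mem_span_singleton.1 hy
    refine ⟨lam, sub_eq_zero.1 ?_⟩
    have hmem : p - q - lam • x ∈ S := by
      have : p - q - lam • x = s + lam • S.starProjection c := by
        rw [← hsy, hx, smul_sub]; abel
      rw [this]
      exact S.add_mem hs (S.smul_mem _ (S.starProjection_apply_mem c))
    rw [← inner_self_eq_zero (𝕜 := ℝ), inner_sub_left, opq _ hmem, inner_smul_left, ox _ hmem]
    simp
  have e1 : projSq v S' - projSq v S = lam ^ 2 * ‖x‖ ^ 2 := by
    have hpq : p = q + lam • x := by rw [← hlam]; abel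
    have : projSq v S' = ‖q‖ ^ 2 + ‖lam • x‖ ^ 2 := by
      rw [projSq, ← hp, hpq, norm_add_sq_real, inner_smul_right, real_inner_comm, ox q hqS]; ring
    rw [this, projSq, ← hq, norm_smul, mul_pow, Real.norm_eq_abs, sq_abs]; ring
  have e2 : inner ℝ (v - q) c = lam * ‖x‖ ^ 2 := by
    have h1 : inner ℝ (v - q) c = inner ℝ (p - q) c := by
      have := op c hc
      simp only [inner_sub_left] at this ⊢; linarith
    have h2 : inner ℝ x c = ‖x‖ ^ 2 := by
      have := ox _ (S.starProjection_apply_mem c)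
      rw [← real_inner_self_eq_norm_sq]
      nth_rw 3 [hx]
      rw [inner_sub_right, this, sub_zero]
    rw [h1, hlam, inner_smul_left, h2]; simp
  rw [e1, e2]; ring

lemma projSq_mono (v : E) {S S' : Submodule ℝ E} (h : S ≤ S') : projSq v S ≤ projSq v S' := by
  have h1 := Submodule.starProjection_comp_starProjection_of_le h
  have h2 : S.starProjection (S'.starProjection v) = S.starProjection v :=
    congr($h1 v)
  rw [projSq, projSq, ← h2]
  gcongr
  exact S.norm_starProjection_apply_le _

lemma norm_sub_starProjection_sq_le (c : E) (S : Submodule ℝ E) :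
    ‖c - S.starProjection c‖ ^ 2 ≤ ‖c‖ ^ 2 := by
  have := projSq_add_norm_sub_sq c S
  have := projSq_nonneg c S
  linarith

lemma inner_sq_le_projSq_sup_span_sub (v c : E) (hc : ‖c‖ = 1) (S : Submodule ℝ E) :
    inner ℝ (v - S.starProjection v) c ^ 2 ≤ projSq v (S ⊔ ℝ ∙ c) - projSq v S := by
  rw [← projSq_sup_span_sub]
  have h1 := norm_sub_starProjection_sq_le c S
  have h2 := projSq_mono v (le_sup_left : S ≤ S ⊔ ℝ ∙ c)
  rw [hc] at h1
  nlinarith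

/-- The bound on `projSq c S` keeps the denominator `‖c - S.starProjection c‖ ^ 2` at least `1/2`;
this is the factor `2`. -/
lemma projSq_sup_span_sub_le (v c : E) (hc : ‖c‖ = 1) (S : Submodule ℝ E)
    (hS : projSq c S ≤ 1 / 2) {r : ℝ} (hr : inner ℝ (v - S.starProjection v) c ^ 2 ≤ r) :
    projSq v (S ⊔ ℝ ∙ c) - projSq v S ≤ 2 * r := by
  have h0 := projSq_sup_span_sub v c S
  have h1 := projSq_add_norm_sub_sq c S
  have h2 := projSq_mono v (le_sup_left : S ≤ S ⊔ ℝ ∙ c)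
  rw [hc] at h1
  nlinarith

lemma projSq_eq_sum_inner_sq (c : E) (S : Submodule ℝ E) {κ : Type*} [Fintype κ]
    (b : OrthonormalBasis κ ℝ S) : projSq c S = ∑ i, inner ℝ c (b i : E) ^ 2 := by
  have h := b.sum_sq_norm_inner_right (S.orthogonalProjectionOnto c)
  rw [projSq, S.starProjection_apply, ← Submodule.coe_norm, ← h]
  refine Finset.sum_congr rfl fun i _ => ?_
  rw [Real.norm_eq_abs, sq_abs, Submodule.coe_inner, real_inner_comm]
  congr 1
  have := Submodule.starProjection_inner_eq_zero (K := S) c (b i) (b i).2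
  rw [inner_sub_left, S.starProjection_apply] at this
  linarith

end Projection

/-! ### Concentration and second moments on the sphere. -/

section Sphere
open scoped Pointwise Real

/-- Surface measure is `d` times the volume of the cone, and normalizing cancels `d`. Caps and
rotations can then be treated through Lebesgue measure. -/
lemma uniformSphere_apply {d : ℕ} (hd : 1 ≤ d) {s : Set (RepSpace d)} (hs : MeasurableSet s) :
    uniformSphere d s = (volume (Metric.ball (0 : RepSpace d) 1))⁻¹ *
      volume (Set.Ioo (0 : ℝ) 1 • (s ∩ Metric.sphere (0 : RepSpace d) 1)) := by
  have hd0 : (d : ENNReal) ≠ 0 := by simp; omega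
  rw [uniformSphere, Measure.map_apply measurable_subtype_coe hs, Measure.smul_apply,
    Measure.toSphere_apply' _ (measurable_subtype_coe hs), Measure.toSphere_apply_univ,
    Subtype.image_preimage_coe, Set.inter_comm, smul_eq_mul, finrank_euclideanSpace_fin,
    ENNReal.mul_inv (Or.inl hd0) (Or.inl (by simp)), mul_mul_mul_comm,
    ENNReal.inv_mul_cancel hd0 (by simp), one_mul]

lemma isProbabilityMeasure_uniformSphere {d : ℕ} (hd : 1 ≤ d) :
    IsProbabilityMeasure (uniformSphere d) := by
  have : Nonempty (Fin d) := ⟨⟨0, hd⟩⟩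
  have : Nontrivial (RepSpace d) := inferInstance
  constructor
  rw [uniformSphere, Measure.map_apply measurable_subtype_coe .univ, Set.preimage_univ,
    Measure.smul_apply, smul_eq_mul]
  exact ENNReal.inv_mul_cancel (by
    rw [Ne, Measure.measure_univ_eq_zero]; exact Measure.toSphere_ne_zero _)
    (measure_ne_top _ _)

lemma ae_norm_eq_one_uniformSphere (d : ℕ) : ∀ᵐ c ∂uniformSphere d, ‖c‖ = 1 := by
  rw [uniformSphere, ae_map_iff measurable_subtype_coe.aemeasurable
    (measurableSet_eq_fun measurable_norm measurable_const)]
  exact Eventually.of_forall fun x => by simp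

/-- A spherical cap has exponentially small measure. -/
lemma uniformSphere_cap_le {d : ℕ} (hd : 1 ≤ d) {u : RepSpace d} (hu : ‖u‖ = 1) {t : ℝ}
    (ht : 0 ≤ t) (ht2 : t ^ 2 ≤ 1 / 2) :
    uniformSphere d {c | t < inner ℝ c u} ≤ ENNReal.ofReal (Real.exp (-(t ^ 2 * d / 2))) := by
  have hm : MeasurableSet {c : RepSpace d | t < inner ℝ c u} :=
    measurableSet_lt measurable_const (by fun_prop)
  -- The cone over the cap fits in a smaller ball: `‖r • c - t • u‖² ≤ r² - 2 r t² + t²`, which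
  -- exceeds `1 - t²` by `(1 - r)(2 t² - 1 - r) ≤ 0`. This is where `t² ≤ 1/2` enters.
  have hsub : Set.Ioo (0 : ℝ) 1 • ({c : RepSpace d | t < inner ℝ c u} ∩ Metric.sphere 0 1) ⊆
      Metric.closedBall (t • u) (√(1 - t ^ 2)) := by
    rintro _ ⟨r, ⟨hr0, hr1⟩, c, ⟨hc, hc1⟩, rfl⟩
    simp only [Set.mem_ofPred_eq] at hc
    rw [mem_sphere_zero_iff_norm] at hc1
    rw [Metric.mem_closedBall, dist_eq_norm]
    apply Real.le_sqrt_of_sq_le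
    simp only
    rw [norm_sub_sq_real, norm_smul, norm_smul, inner_smul_left, inner_smul_right, hu, hc1]
    simp only [Real.norm_eq_abs, mul_one, sq_abs, conj_trivial]
    nlinarith [mul_nonneg hr0.le ht, mul_le_mul_of_nonneg_left hc.le (mul_nonneg hr0.le ht)]
  have : Nonempty (Fin d) := ⟨⟨0, hd⟩⟩
  have hb0 : volume (Metric.ball (0 : RepSpace d) 1) ≠ 0 :=
    (Metric.measure_ball_pos _ _ one_pos).ne'
  rw [uniformSphere_apply hd hm]
  refine (mul_le_mul_right (measure_mono hsub) _).trans ?_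
  rw [Measure.addHaar_closedBall _ _ (Real.sqrt_nonneg _), mul_comm, mul_assoc,
    ENNReal.mul_inv_cancel hb0 measure_ball_lt_top.ne, mul_one, finrank_euclideanSpace_fin]
  apply ENNReal.ofReal_le_ofReal
  have h1 : √(1 - t ^ 2) ≤ Real.exp (-(t ^ 2 / 2)) := by
    apply Real.sqrt_le_iff.2 ⟨(Real.exp_pos _).le, ?_⟩
    rw [← Real.exp_nat_mul]
    have := Real.add_one_le_exp (-t ^ 2)
    convert! (show 1 - t ^ 2 ≤ Real.exp (-t ^ 2) by linarith) using 2
    push_cast; ring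
  calc √(1 - t ^ 2) ^ d ≤ Real.exp (-(t ^ 2 / 2)) ^ d := by gcongr
    _ = Real.exp (-(t ^ 2 * d / 2)) := by rw [← Real.exp_nat_mul]; congr 1; ring

/-- For `u ≠ 0` the event lies in two opposite caps of height `√r`. Norms below one are allowed
because `u` will be a residual `v - S.starProjection v`. -/
lemma uniformSphere_inner_sq_gt_le {d : ℕ} (hd : 1 ≤ d) {u : RepSpace d} (hu : ‖u‖ ≤ 1) {r : ℝ}
    (hr : 0 ≤ r) (hr2 : r ≤ 1 / 2) :
    uniformSphere d {c | r < inner ℝ u c ^ 2} ≤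
      2 * ENNReal.ofReal (Real.exp (-(r * d / 2))) := by
  rcases eq_or_ne u 0 with rfl | hu0
  · simp [not_lt.2 hr]
  have hn : 0 < ‖u‖ := norm_pos_iff.2 hu0
  set w : RepSpace d := ‖u‖⁻¹ • u with hw
  have hw1 : ‖w‖ = 1 := by rw [hw, norm_smul, norm_inv, norm_norm, inv_mul_cancel₀ hn.ne']
  have hs : √r ^ 2 = r := Real.sq_sqrt hr
  have hsub : {c | r < inner ℝ u c ^ 2} ⊆
      {c : RepSpace d | √r < inner ℝ c w} ∪ {c | √r < inner ℝ c (-w)} := by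
    intro c hc
    simp only [Set.mem_ofPred_eq, Set.mem_union] at hc ⊢
    have huw : inner ℝ u c = ‖u‖ * inner ℝ c w := by
      rw [hw, inner_smul_right, ← mul_assoc, mul_inv_cancel₀ hn.ne', one_mul, real_inner_comm]
    rw [inner_neg_right, ← lt_abs]
    refine (Real.sqrt_lt_sqrt hr hc).trans_le ?_
    rw [huw, Real.sqrt_sq_eq_abs, abs_mul, abs_of_pos hn]
    exact mul_le_of_le_one_left (abs_nonneg _) hu
  refine (measure_mono hsub).trans ((measure_union_le _ _).trans ?_)
  rw [two_mul, ← hs]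
  simp only [Real.sqrt_sq (Real.sqrt_nonneg r)]
  exact add_le_add (uniformSphere_cap_le hd hw1 (Real.sqrt_nonneg _) (by rwa [hs]))
    (uniformSphere_cap_le hd (by rwa [norm_neg]) (Real.sqrt_nonneg _) (by rwa [hs]))

lemma map_uniformSphere {d : ℕ} (hd : 1 ≤ d) (f : RepSpace d ≃ₗᵢ[ℝ] RepSpace d) :
    (uniformSphere d).map f = uniformSphere d := by
  ext s hs
  have hf : Measurable f := f.continuous.measurable
  rw [Measure.map_apply hf hs, uniformSphere_apply hd (hf hs), uniformSphere_apply hd hs]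
  congr 1
  conv_rhs => rw [← f.measurePreserving.measure_preimage_equiv (f := f.toMeasurableEquiv)]
  congr 1
  ext x
  simp only [Set.mem_smul, Set.mem_inter_iff, Set.mem_preimage, mem_sphere_zero_iff_norm]
  constructor
  · rintro ⟨r, hr, y, ⟨hy, hy1⟩, rfl⟩
    exact ⟨r, hr, f y, ⟨hy, by simpa using hy1⟩, by simp⟩
  · rintro ⟨r, hr, y, ⟨hy, hy1⟩, hxy⟩
    refine ⟨r, hr, f.symm y, ⟨by simpa using hy, by simpa using hy1⟩, f.injective ?_⟩
    simpa using! hxy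

lemma integrable_inner_sq_uniformSphere {d : ℕ} (hd : 1 ≤ d) (w : RepSpace d) :
    Integrable (fun c => inner ℝ w c ^ 2) (uniformSphere d) := by
  have := isProbabilityMeasure_uniformSphere hd
  refine Integrable.of_bound (by fun_prop) (‖w‖ ^ 2) ?_
  filter_upwards [ae_norm_eq_one_uniformSphere d] with c hc
  rw [Real.norm_eq_abs, abs_pow]
  gcongr
  simpa [hc] using abs_real_inner_le_norm w c

/-- A reflection carries `w` to `w'` and preserves the uniform measure. -/
lemma integral_inner_sq_uniformSphere_congr {d : ℕ} (hd : 1 ≤ d) {w w' : RepSpace d}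
    (h : ‖w‖ = ‖w'‖) :
    ∫ c, inner ℝ w c ^ 2 ∂uniformSphere d = ∫ c, inner ℝ w' c ^ 2 ∂uniformSphere d := by
  set f := (ℝ ∙ (w - w'))ᗮ.reflection
  have hf : f w = w' := Submodule.reflection_sub h
  rw [← hf]
  conv_rhs => rw [← map_uniformSphere hd f]
  rw [integral_map f.continuous.measurable.aemeasurable
    (Continuous.aestronglyMeasurable (by fun_prop))]
  simp only [LinearIsometryEquiv.inner_map_map]

/-- By symmetry all `d` coordinate directions contribute equally, and by Parseval their
contributions add up to `‖w‖ ^ 2`. -/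
lemma integral_inner_sq_uniformSphere {d : ℕ} (hd : 1 ≤ d) (w : RepSpace d) :
    ∫ c, inner ℝ w c ^ 2 ∂uniformSphere d = ‖w‖ ^ 2 / d := by
  have := isProbabilityMeasure_uniformSphere hd
  have hd0 : (d : ℝ) ≠ 0 := by positivity
  set b := EuclideanSpace.basisFun (Fin d) ℝ
  have hi : ∀ i, ∫ c, inner ℝ w c ^ 2 ∂uniformSphere d
      = ∫ c, inner ℝ (‖w‖ • b i) c ^ 2 ∂uniformSphere d := fun i =>
    integral_inner_sq_uniformSphere_congr hd (by simp [norm_smul])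
  have hsum : ∑ i : Fin d, ∫ c, inner ℝ (‖w‖ • b i) c ^ 2 ∂uniformSphere d = ‖w‖ ^ 2 := by
    rw [← integral_finsetSum _ fun i _ => integrable_inner_sq_uniformSphere hd _]
    rw [integral_congr_ae (g := fun _ => ‖w‖ ^ 2)]
    · simp
    · filter_upwards [ae_norm_eq_one_uniformSphere d] with c hc
      have := b.sum_sq_norm_inner_right c
      simp only [Real.norm_eq_abs, sq_abs, hc] at this
      simp only [inner_smul_left, mul_pow, ← Finset.mul_sum, this]
      simp
  rw [← Finset.sum_congr rfl fun i _ => hi i, Finset.sum_const, Finset.card_univ, Fintype.card_fin,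
    nsmul_eq_mul] at hsum
  field_simp
  linarith

/-- Adding a random direction to a subspace of small dimension changes a squared projection
only a little, with high probability. -/
lemma uniformSphere_projSq_gt_le {d : ℕ} (hd : 1 ≤ d) {v : RepSpace d} (hv : ‖v‖ = 1)
    (S : Submodule ℝ (RepSpace d)) {r : ℝ} (hr : 0 ≤ r) (hr2 : r ≤ 1 / 2) {N : ℕ}
    (hN : Module.finrank ℝ S ≤ N) (hNr : N * r ≤ 1 / 2) :
    uniformSphere d {c | 2 * r < projSq v (S ⊔ ℝ ∙ c) - projSq v S} ≤
      (N + 1) * (2 * ENNReal.ofReal (Real.exp (-(r * d / 2)))) := by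
  set b := stdOrthonormalBasis ℝ S
  set u := v - S.starProjection v
  have hu : ‖u‖ ≤ 1 := by
    have := norm_sub_starProjection_sq_le v S
    rw [hv] at this
    exact (sq_le_sq₀ (norm_nonneg _) zero_le_one).1 this
  -- Outside these bad events the numerator is at most `r`, and each coordinate of `c` along `b` has
  -- square at most `r`, so `projSq c S ≤ N * r ≤ 1 / 2`.
  have hsub : {c | 2 * r < projSq v (S ⊔ ℝ ∙ c) - projSq v S} ⊆
      ({c | r < inner ℝ u c ^ 2} ∪ ⋃ i, {c | r < inner ℝ (b i : RepSpace d) c ^ 2}) ∪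
        {c | ¬ ‖c‖ = 1} := by
    intro c hc
    by_contra hcon
    simp only [Set.mem_union, Set.mem_iUnion, Set.mem_ofPred_eq, not_or, not_lt, not_exists,
      not_not] at hcon hc
    obtain ⟨⟨h1, h2⟩, h3⟩ := hcon
    refine absurd (projSq_sup_span_sub_le v c h3 S ?_ h1) (not_le.2 hc)
    rw [projSq_eq_sum_inner_sq c S b]
    calc ∑ i, inner ℝ c (b i : RepSpace d) ^ 2
        ≤ ∑ i : Fin (Module.finrank ℝ S), r := by
          refine Finset.sum_le_sum fun i _ => ?_
          rw [real_inner_comm]; exact h2 i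
      _ = Module.finrank ℝ S * r := by simp
      _ ≤ N * r := by gcongr
      _ ≤ 1 / 2 := hNr
  refine (measure_mono hsub).trans ((measure_union_le _ _).trans ?_)
  rw [show uniformSphere d {c | ¬ ‖c‖ = 1} = 0 from ae_norm_eq_one_uniformSphere d, add_zero]
  refine (measure_union_le _ _).trans ?_
  rw [add_mul, one_mul, add_comm]
  refine add_le_add ((measure_iUnion_fintype_le _ _).trans ?_)
    (uniformSphere_inner_sq_gt_le hd hu hr hr2)
  refine (Finset.sum_le_sum fun i _ => uniformSphere_inner_sq_gt_le hd ?_ hr hr2).trans ?_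
  · simpa only [Submodule.coe_norm] using (b.orthonormal.1 i).le
  · rw [Finset.sum_const, Finset.card_univ, Fintype.card_fin, nsmul_eq_mul]
    gcongr

end Sphere

/-! ### Spans of independent random directions. -/

section RandomSpan

lemma norm_sub_starProjection_le {E : Type*} [NormedAddCommGroup E] [InnerProductSpace ℝ E]
    [FiniteDimensional ℝ E] (v : E) {S : Submodule ℝ E} {y : E} (hy : y ∈ S) :
    ‖v - S.starProjection v‖ ≤ ‖v - y‖ := by
  rw [Submodule.starProjection_minimal]
  exact ciInf_le (f := fun x : S => ‖v - x‖) ⟨0, by rintro _ ⟨x, rfl⟩; exact norm_nonneg _⟩ ⟨y, hy⟩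

/-- The projection may jump where the span drops dimension, but the distance to the span is an
infimum of functions continuous in `c`, so its strict sublevel sets are open. -/
lemma measurable_projSq_sup_span {d m : ℕ} (v : RepSpace d) (S : Submodule ℝ (RepSpace d)) :
    Measurable fun c : Fin m → RepSpace d => projSq v (S ⊔ Submodule.span ℝ (Set.range c)) := by
  have h : Measurable fun c : Fin m → RepSpace d =>
      ‖v - (S ⊔ Submodule.span ℝ (Set.range c)).starProjection v‖ := by
    refine measurable_of_Iio fun r => IsOpen.measurableSet ?_
    have : (fun c : Fin m → RepSpace d =>
        ‖v - (S ⊔ Submodule.span ℝ (Set.range c)).starProjection v‖) ⁻¹' Set.Iio r =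
        ⋃ (s ∈ S) (q : Fin m → ℝ), {c | ‖v - (s + ∑ i, q i • c i)‖ < r} := by
      ext c
      simp only [Set.mem_preimage, Set.mem_Iio, Set.mem_iUnion, Set.mem_ofPred_eq]
      constructor
      · intro hc
        obtain ⟨s, hs, y, hy, hsy⟩ := Submodule.mem_sup.1 (Submodule.starProjection_apply_mem
          (S ⊔ Submodule.span ℝ (Set.range c)) v)
        obtain ⟨q, rfl⟩ := (Submodule.mem_span_range_iff_exists_fun ℝ).1 hy
        exact ⟨s, hs, q, by rwa [hsy]⟩
      · rintro ⟨s, hs, q, hq⟩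
        refine (norm_sub_starProjection_le v ?_).trans_lt hq
        exact Submodule.add_mem_sup hs ((Submodule.mem_span_range_iff_exists_fun ℝ).2 ⟨q, rfl⟩)
    rw [this]
    exact isOpen_biUnion fun s _ => isOpen_iUnion fun q =>
      isOpen_lt (by fun_prop) continuous_const
  have h2 : (fun c : Fin m → RepSpace d => projSq v (S ⊔ Submodule.span ℝ (Set.range c))) =
      fun c => ‖v‖ ^ 2 - ‖v - (S ⊔ Submodule.span ℝ (Set.range c)).starProjection v‖ ^ 2 := by
    funext c
    rw [← projSq_add_norm_sub_sq v (S ⊔ Submodule.span ℝ (Set.range c)), add_sub_cancel_right]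
  rw [h2]
  exact measurable_const.sub (h.pow_const 2)

lemma measurable_projSq_sup_span_singleton {d : ℕ} (v : RepSpace d)
    (S : Submodule ℝ (RepSpace d)) : Measurable fun c : RepSpace d => projSq v (S ⊔ ℝ ∙ c) := by
  have h := (measurable_projSq_sup_span (m := 1) v S).comp
    (measurable_pi_lambda (fun (c : RepSpace d) (_ : Fin 1) => c) fun _ => measurable_id)
  simpa [Function.comp_def] using h

/-- Splits off the first direction, so that an induction can absorb it into `S` and integrate over
the others. -/
lemma measurePreserving_finCons {α : Type*} [MeasurableSpace α] (μ : Measure α) [SigmaFinite μ]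
    (m : ℕ) : MeasurePreserving (fun p : α × (Fin m → α) => (Fin.cons p.1 p.2 : Fin (m + 1) → α))
      (μ.prod (Measure.pi fun _ => μ)) (Measure.pi fun _ => μ) := by
  have h := (measurePreserving_piFinSuccAbove (fun _ : Fin (m + 1) => μ) 0).symm
  convert! h using 1
  funext p
  exact (Fin.insertNth_zero' p.1 p.2).symm

lemma sup_span_range_cons {d m : ℕ} (S : Submodule ℝ (RepSpace d)) (x : RepSpace d)
    (c : Fin m → RepSpace d) :
    S ⊔ Submodule.span ℝ (Set.range (Fin.cons x c : Fin (m + 1) → RepSpace d)) =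
      (S ⊔ ℝ ∙ x) ⊔ Submodule.span ℝ (Set.range c) := by
  rw [Fin.range_cons, Submodule.span_insert, sup_assoc]

/-- Adding `m` independent random directions to a subspace changes a squared projection by
`O(m r)`, outside an event of exponentially small probability. -/
lemma pi_uniformSphere_projSq_gt_le {d : ℕ} (hd : 1 ≤ d) {v : RepSpace d} (hv : ‖v‖ = 1) {r : ℝ}
    (hr : 0 ≤ r) (hr2 : r ≤ 1 / 2) {N : ℕ} (hNr : N * r ≤ 1 / 2) (m : ℕ) :
    ∀ S : Submodule ℝ (RepSpace d), Module.finrank ℝ S + m ≤ N →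
    Measure.pi (fun _ : Fin m => uniformSphere d)
      {c | m * (2 * r) < projSq v (S ⊔ Submodule.span ℝ (Set.range c)) - projSq v S} ≤
      m * ((N + 1) * (2 * ENNReal.ofReal (Real.exp (-(r * d / 2))))) := by
  have := isProbabilityMeasure_uniformSphere hd
  set μ := uniformSphere d
  set b : ENNReal := (N + 1) * (2 * ENNReal.ofReal (Real.exp (-(r * d / 2)))) with hb
  induction m with
  | zero => intro S _; simp
  | succ m ih =>
    intro S hS
    have hmeas : MeasurableSet {c : Fin (m + 1) → RepSpace d | ((m + 1 : ℕ) : ℝ) * (2 * r) <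
        projSq v (S ⊔ Submodule.span ℝ (Set.range c)) - projSq v S} :=
      measurableSet_lt measurable_const ((measurable_projSq_sup_span v S).sub_const _)
    have hbad : MeasurableSet {x | 2 * r < projSq v (S ⊔ ℝ ∙ x) - projSq v S} :=
      measurableSet_lt measurable_const ((measurable_projSq_sup_span_singleton v S).sub_const _)
    have hmp := measurePreserving_finCons μ m
    rw [← hmp.measure_preimage hmeas.nullMeasurableSet, Measure.prod_apply (hmp.measurable hmeas)]
    -- Condition on the first direction `x`. If its gain exceeds `2 * r`, bound the probability by
    -- one; otherwise the other `m` directions must gain more than `m * (2 * r)` over `S ⊔ ℝ ∙ x`,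
    -- whose dimension is larger by at most one, so the same `N` serves.
    have hle : ∀ x, Measure.pi (fun _ : Fin m => μ) (Prod.mk x ⁻¹'
        ((fun p : RepSpace d × (Fin m → RepSpace d) =>
          (Fin.cons p.1 p.2 : Fin (m + 1) → RepSpace d)) ⁻¹'
        {c | ((m + 1 : ℕ) : ℝ) * (2 * r) <
          projSq v (S ⊔ Submodule.span ℝ (Set.range c)) - projSq v S})) ≤
        Set.indicator {x | 2 * r < projSq v (S ⊔ ℝ ∙ x) - projSq v S} 1 x + m * b := by
      intro x
      by_cases hx : x ∈ {x | 2 * r < projSq v (S ⊔ ℝ ∙ x) - projSq v S}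
      · rw [Set.indicator_of_mem hx]
        exact prob_le_one.trans le_self_add
      · rw [Set.indicator_of_notMem hx, zero_add]
        refine (measure_mono ?_).trans (ih (S ⊔ ℝ ∙ x) ?_)
        · intro c hc
          simp only [Set.mem_preimage, Set.mem_ofPred_eq, not_lt] at hc hx ⊢
          rw [sup_span_range_cons] at hc
          push_cast at hc
          linarith
        · have h1 := Submodule.finrank_add_le_finrank_add_finrank S (ℝ ∙ x)
          have h2 := finrank_span_le_card (R := ℝ) ({x} : Set (RepSpace d))
          simp only [Set.toFinset_singleton, Finset.card_singleton] at h2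
          omega
    refine (lintegral_mono hle).trans ?_
    rw [lintegral_add_right _ measurable_const, lintegral_indicator_one hbad, lintegral_const,
      measure_univ, mul_one]
    push_cast
    rw [add_mul, one_mul, add_comm]
    gcongr
    exact uniformSphere_projSq_gt_le hd hv S hr hr2 (by omega) hNr

lemma integrable_projSq_sup_span {d m : ℕ} (hd : 1 ≤ d) (v : RepSpace d)
    (S : Submodule ℝ (RepSpace d)) :
    Integrable (fun c => projSq v (S ⊔ Submodule.span ℝ (Set.range c)))
      (Measure.pi fun _ : Fin m => uniformSphere d) := by
  have := isProbabilityMeasure_uniformSphere hd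
  refine Integrable.of_bound (measurable_projSq_sup_span v S).aestronglyMeasurable (‖v‖ ^ 2)
    (Eventually.of_forall fun c => ?_)
  rw [Real.norm_eq_abs, abs_of_nonneg (projSq_nonneg _ _)]
  exact projSq_le _ _

lemma integrable_projSq_sup_span_singleton {d : ℕ} (hd : 1 ≤ d) (v : RepSpace d)
    (S : Submodule ℝ (RepSpace d)) :
    Integrable (fun c => projSq v (S ⊔ ℝ ∙ c)) (uniformSphere d) := by
  have := isProbabilityMeasure_uniformSphere hd
  refine Integrable.of_bound (measurable_projSq_sup_span_singleton v S).aestronglyMeasurable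
    (‖v‖ ^ 2) (Eventually.of_forall fun c => ?_)
  rw [Real.norm_eq_abs, abs_of_nonneg (projSq_nonneg _ _)]
  exact projSq_le _ _

/-- Dropping the denominator leaves a gain of mean `‖v - S.starProjection v‖ ^ 2 / d`, and that
squared norm is `1 - projSq v S`. -/
lemma integral_one_sub_projSq_sup_span_singleton_le {d : ℕ} (hd : 1 ≤ d) {v : RepSpace d}
    (hv : ‖v‖ = 1) (S : Submodule ℝ (RepSpace d)) :
    ∫ c, (1 - projSq v (S ⊔ ℝ ∙ c)) ∂uniformSphere d ≤ (1 - 1 / d) * (1 - projSq v S) := by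
  have := isProbabilityMeasure_uniformSphere hd
  have h1 := projSq_add_norm_sub_sq v S
  rw [hv, one_pow] at h1
  calc ∫ c, (1 - projSq v (S ⊔ ℝ ∙ c)) ∂uniformSphere d
      ≤ ∫ c, ((1 - projSq v S) - inner ℝ (v - S.starProjection v) c ^ 2) ∂uniformSphere d := by
        refine integral_mono_ae
          ((integrable_const _).sub (integrable_projSq_sup_span_singleton hd v S))
          ((integrable_const _).sub (integrable_inner_sq_uniformSphere hd _)) ?_
        filter_upwards [ae_norm_eq_one_uniformSphere d] with c hc
        have := inner_sq_le_projSq_sup_span_sub v c hc S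
        linarith
    _ = (1 - 1 / d) * (1 - projSq v S) := by
        rw [integral_sub (integrable_const _) (integrable_inner_sq_uniformSphere hd _),
          integral_inner_sq_uniformSphere hd, integral_const]
        simp only [probReal_univ, one_smul]
        rw [eq_sub_of_add_eq' h1]; ring

/-- The expected squared distance to a random subspace decays geometrically. -/
lemma integral_one_sub_projSq_sup_span_le {d : ℕ} (hd : 1 ≤ d) {v : RepSpace d}
    (hv : ‖v‖ = 1) (m : ℕ) : ∀ S : Submodule ℝ (RepSpace d),
    ∫ c, (1 - projSq v (S ⊔ Submodule.span ℝ (Set.range c)))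
      ∂(Measure.pi fun _ : Fin m => uniformSphere d) ≤ (1 - 1 / d) ^ m * (1 - projSq v S) := by
  have := isProbabilityMeasure_uniformSphere hd
  have hd1 : (0 : ℝ) ≤ 1 - 1 / d := by
    rw [sub_nonneg]; exact div_le_one_of_le₀ (by exact_mod_cast hd) (by positivity)
  induction m with
  | zero => intro S; simp
  | succ m ih =>
    intro S
    have hmp := measurePreserving_finCons (uniformSphere d) m
    have hint := ((integrable_const (1 : ℝ)).sub (integrable_projSq_sup_span (m := m + 1) hd v S))
    have hint' := hmp.integrable_comp_of_integrable hint
    rw [← hmp.map_eq, integral_map hmp.measurable.aemeasurable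
      (by rw [hmp.map_eq]; exact hint.aestronglyMeasurable)]
    simp only [Function.comp_def, Pi.sub_apply, sup_span_range_cons] at hint' ⊢
    rw [integral_prod _ hint']
    calc _ ≤ ∫ x, (1 - 1 / (d : ℝ)) ^ m * (1 - projSq v (S ⊔ ℝ ∙ x)) ∂uniformSphere d := by
          refine integral_mono ?_ ?_ fun x => ih (S ⊔ ℝ ∙ x)
          · exact hint'.integral_prod_left
          · exact ((integrable_const _).sub
              (integrable_projSq_sup_span_singleton hd v S)).const_mul _
      _ ≤ (1 - 1 / (d : ℝ)) ^ m * ((1 - 1 / d) * (1 - projSq v S)) := by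
          rw [integral_const_mul]
          gcongr
          exact integral_one_sub_projSq_sup_span_singleton_le hd hv S
      _ = _ := by ring

lemma packingTax_eq_projSq {d m' : ℕ} {ι Ω : Type*} [Finite ι] (v : RepSpace d)
    (a : ι → RepSpace d) (c : Fin m' → Ω → RepSpace d) (ω : Ω) :
    packingTax v a c ω = projSq v (Submodule.span ℝ (Set.range a) ⊔
      Submodule.span ℝ (Set.range fun j => c j ω)) := by
  have h : Submodule.span ℝ (Set.range (Sum.elim a fun j => c j ω)) =
      Submodule.span ℝ (Set.range a) ⊔ Submodule.span ℝ (Set.range fun j => c j ω) := by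
    rw [Set.Sum.elim_range, Submodule.span_union]
  simp only [packingTax, taxRate, projSq, h]

lemma IsRandomPacking.hasLaw_pi {d m' : ℕ} {ι Ω : Type*} [MeasurableSpace Ω]
    {P : Measure Ω} [IsProbabilityMeasure P] {v : RepSpace d} {a : ι → RepSpace d}
    {c : Fin m' → Ω → RepSpace d} (h : IsRandomPacking P v a c) :
    HasLaw (fun ω j => c j ω) (Measure.pi fun _ => uniformSphere d) P where
  aemeasurable := aemeasurable_pi_lambda _ fun j => (h.uniform j).aemeasurable
  map_eq := by
    rw [(iIndepFun_iff_map_fun_eq_pi_map fun j => (h.uniform j).aemeasurable).1 h.indep]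
    congr 1
    funext j
    exact (h.uniform j).map_eq

lemma IsRandomPacking.measure_tax_gt_le {d m' : ℕ} (hd : 1 ≤ d) {ι Ω : Type*} [Fintype ι]
    [MeasurableSpace Ω] {P : Measure Ω} [IsProbabilityMeasure P] {v : RepSpace d}
    {a : ι → RepSpace d} {c : Fin m' → Ω → RepSpace d} (h : IsRandomPacking P v a c) {r : ℝ}
    (hr : 0 ≤ r) (hr2 : r ≤ 1 / 2) (hNr : ((Fintype.card ι + m' : ℕ) : ℝ) * r ≤ 1 / 2) :
    P.real {ω | m' * (2 * r) <
      packingTax v a c ω - projSq v (Submodule.span ℝ (Set.range a))} ≤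
      m' * ((Fintype.card ι + m' + 1) * (2 * Real.exp (-(r * d / 2)))) := by
  set S := Submodule.span ℝ (Set.range a)
  have hS : Module.finrank ℝ S + m' ≤ Fintype.card ι + m' :=
    Nat.add_le_add_right (finrank_range_le_card a) _
  have hle := pi_uniformSphere_projSq_gt_le hd h.norm_v hr hr2 hNr m' S hS
  have hmeas : MeasurableSet {c : Fin m' → RepSpace d | m' * (2 * r) <
      projSq v (S ⊔ Submodule.span ℝ (Set.range c)) - projSq v S} :=
    measurableSet_lt measurable_const ((measurable_projSq_sup_span v S).sub_const _)
  rw [← (h.hasLaw_pi).measure_eq hmeas] at hle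
  simp only [packingTax_eq_projSq]
  refine ENNReal.toReal_le_of_le_ofReal (by positivity) (hle.trans_eq ?_)
  rw [ENNReal.ofReal_mul (by positivity), ENNReal.ofReal_mul (by positivity),
    ENNReal.ofReal_mul (by positivity)]
  simp [ENNReal.ofReal_add, add_nonneg]

lemma IsRandomPacking.integrable_packingTax {d m' : ℕ} (hd : 1 ≤ d) {ι Ω : Type*} [Fintype ι]
    [MeasurableSpace Ω] {P : Measure Ω} [IsProbabilityMeasure P] {v : RepSpace d}
    {a : ι → RepSpace d} {c : Fin m' → Ω → RepSpace d} (h : IsRandomPacking P v a c) :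
    Integrable (packingTax v a c) P := by
  have hlaw := h.hasLaw_pi
  have hint := integrable_projSq_sup_span (m := m') hd v (Submodule.span ℝ (Set.range a))
  rw [← hlaw.map_eq] at hint
  have := hint.comp_aemeasurable hlaw.aemeasurable
  refine this.congr (Eventually.of_forall fun ω => ?_)
  exact (packingTax_eq_projSq v a c ω).symm

lemma packingTax_le_one {d m' : ℕ} {ι Ω : Type*} [Finite ι] {v : RepSpace d} (hv : ‖v‖ = 1)
    (a : ι → RepSpace d) (c : Fin m' → Ω → RepSpace d) (ω : Ω) : packingTax v a c ω ≤ 1 := by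
  rw [packingTax_eq_projSq]
  simpa [hv] using projSq_le v _

lemma IsRandomPacking.one_sub_le_integral_packingTax {d m' : ℕ} (hd : 1 ≤ d) {ι Ω : Type*}
    [Fintype ι] [MeasurableSpace Ω] {P : Measure Ω} [IsProbabilityMeasure P] {v : RepSpace d}
    {a : ι → RepSpace d} {c : Fin m' → Ω → RepSpace d} (h : IsRandomPacking P v a c) :
    1 - (1 - 1 / (d : ℝ)) ^ m' * (1 - projSq v (Submodule.span ℝ (Set.range a))) ≤
      ∫ ω, packingTax v a c ω ∂P := by
  have hlaw := h.hasLaw_pi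
  have := isProbabilityMeasure_uniformSphere hd
  have hint := integrable_projSq_sup_span (m := m') hd v (Submodule.span ℝ (Set.range a))
  have hle := integral_one_sub_projSq_sup_span_le hd h.norm_v m' (Submodule.span ℝ (Set.range a))
  rw [integral_sub (integrable_const _) hint, integral_const, probReal_univ, one_smul] at hle
  have heq : ∫ ω, packingTax v a c ω ∂P = ∫ c, projSq v (Submodule.span ℝ (Set.range a) ⊔
      Submodule.span ℝ (Set.range c)) ∂(Measure.pi fun _ : Fin m' => uniformSphere d) := by
    rw [← hlaw.map_eq] at hint
    rw [← hlaw.map_eq, integral_map hlaw.aemeasurable hint.aestronglyMeasurable]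
    simp only [packingTax_eq_projSq]
  rw [heq]; linarith

end RandomSpan

/-! ### Projection to an almost orthonormal family. -/

section Gram

variable {E : Type*} [NormedAddCommGroup E] [InnerProductSpace ℝ E] {ι : Type*} [Fintype ι]

/-- The difference is the quadratic form of the Gram matrix minus the identity, whose diagonal
vanishes and whose other entries are at most `ε` in absolute value. -/
lemma abs_norm_sum_smul_sq_sub_le {a : ι → E} (ha : ∀ i, ‖a i‖ = 1) {ε : ℝ} (hε : 0 ≤ ε)
    (h : ∀ i j, i ≠ j → |inner ℝ (a i) (a j)| ≤ ε) (x : ι → ℝ) :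
    |‖∑ i, x i • a i‖ ^ 2 - ∑ i, x i ^ 2| ≤ ε * (∑ i, |x i|) ^ 2 := by
  classical
  have h1 : ‖∑ i, x i • a i‖ ^ 2 - ∑ i, x i ^ 2 =
      ∑ i, ∑ j, x i * x j * (inner ℝ (a i) (a j) - if i = j then 1 else 0) := by
    rw [← real_inner_self_eq_norm_sq, sum_inner, ← Finset.sum_sub_distrib]
    refine Finset.sum_congr rfl fun i _ => ?_
    rw [inner_sum]
    simp only [mul_sub, Finset.sum_sub_distrib, inner_smul_left, inner_smul_right]
    congr 1
    · exact Finset.sum_congr rfl fun j _ => by simp; ring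
    · simp [sq]
  rw [h1, sq, Finset.sum_mul_sum, Finset.mul_sum]
  refine (Finset.abs_sum_le_sum_abs _ _).trans (Finset.sum_le_sum fun i _ => ?_)
  rw [Finset.mul_sum]
  refine (Finset.abs_sum_le_sum_abs _ _).trans (Finset.sum_le_sum fun j _ => ?_)
  rw [abs_mul, abs_mul, mul_comm]
  gcongr
  by_cases hij : i = j
  · subst hij
    simpa [real_inner_self_eq_norm_sq, ha] using hε
  · simpa [hij] using h i j hij

/-- The squared projection of a unit vector to the span of almost orthogonal unit vectors. -/
lemma abs_projSq_span_sub_le [FiniteDimensional ℝ E] {v : E} (hv : ‖v‖ = 1) {a : ι → E}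
    (ha : ∀ i, ‖a i‖ = 1) {γ : ι → ℝ} {ε : ℝ} (hε : 0 ≤ ε) (hε1 : ε ≤ 1)
    (hva : ∀ i, |inner ℝ v (a i) - γ i| ≤ ε)
    (haa : ∀ i j, i ≠ j → |inner ℝ (a i) (a j)| ≤ ε) :
    |projSq v (Submodule.span ℝ (Set.range a)) - ∑ i, γ i ^ 2| ≤
      (2 * ∑ i, |γ i| + (∑ i, |γ i|) ^ 2 + 2 * Fintype.card ι) * ε := by
  set S := Submodule.span ℝ (Set.range a)
  set T := projSq v S
  set L := ∑ i, |γ i|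
  have hL : 0 ≤ L := Finset.sum_nonneg fun _ _ => abs_nonneg _
  have hT : T + ‖v - S.starProjection v‖ ^ 2 = 1 := by simpa [hv] using projSq_add_norm_sub_sq v S
  have hT0 : 0 ≤ T := projSq_nonneg v S
  have hn0 : (0 : ℝ) ≤ Fintype.card ι := by positivity
  -- The projection is the nearest point of `S`; compare it with the candidate `∑ i, γ i • a i`.
  have lower : ∑ i, γ i ^ 2 - T ≤ (2 * L + L ^ 2) * ε := by
    have hw : ∑ i, γ i • a i ∈ S := (Submodule.mem_span_range_iff_exists_fun ℝ).2 ⟨γ, rfl⟩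
    have h1 : ‖v - S.starProjection v‖ ^ 2 ≤ ‖v - ∑ i, γ i • a i‖ ^ 2 := by
      gcongr; exact norm_sub_starProjection_le v hw
    rw [norm_sub_sq_real v (∑ i, γ i • a i), hv, inner_sum] at h1
    simp only [inner_smul_right] at h1
    have h2 := (abs_le.1 (abs_norm_sum_smul_sq_sub_le ha hε haa γ)).2
    have h3 : ∑ i, γ i ^ 2 - ∑ i, γ i * inner ℝ v (a i) ≤ L * ε := by
      rw [← Finset.sum_sub_distrib, Finset.sum_mul]
      refine Finset.sum_le_sum fun i _ => ?_
      calc γ i ^ 2 - γ i * inner ℝ v (a i) ≤ |γ i * (inner ℝ v (a i) - γ i)| := by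
            refine le_trans (le_of_eq ?_) (neg_le_abs _); ring
        _ ≤ |γ i| * ε := by rw [abs_mul]; gcongr; exact hva i
    nlinarith
  -- Write the projection as `∑ i, x i • a i`. Cauchy-Schwarz gives `T² ≤ (∑ x i²) G`, and near
  -- orthogonality bounds `(1 - n ε) ∑ x i²` by `T`, with `n` the cardinality of `ι`. Hence `(1 - n
  -- ε) T ≤ G`, and `T ≤ 1` moves `n ε T` to the error; `ε² ≤ ε` is used to bound `G`.
  have upper : T - ∑ i, γ i ^ 2 ≤ (2 * L + 2 * Fintype.card ι) * ε := by
    obtain ⟨x, hx⟩ := (Submodule.mem_span_range_iff_exists_fun ℝ).1 (S.starProjection_apply_mem v)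
    have hTx : T = ∑ i, x i * inner ℝ v (a i) := by
      rw [show T = _ from projSq_eq_inner v S, ← hx, inner_sum]
      simp only [inner_smul_right]
    have hG : ∑ i, inner ℝ v (a i) ^ 2 ≤ ∑ i, γ i ^ 2 + (2 * L + Fintype.card ι) * ε := by
      calc ∑ i, inner ℝ v (a i) ^ 2 ≤ ∑ i, (γ i ^ 2 + (2 * |γ i| * ε + ε)) := by
            refine Finset.sum_le_sum fun i _ => ?_
            have h1 := hva i
            have h2 : |inner ℝ v (a i)| ≤ |γ i| + ε := by
              have := abs_sub_abs_le_abs_sub (inner ℝ v (a i)) (γ i)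
              linarith
            rw [← sq_abs, ← sq_abs (γ i)]
            have := abs_nonneg (γ i)
            have := pow_le_pow_left₀ (abs_nonneg _) h2 2
            nlinarith
        _ = _ := by
            rw [Finset.sum_add_distrib, Finset.sum_add_distrib, ← Finset.sum_mul,
              ← Finset.mul_sum]
            simp; ring
    set G := ∑ i, inner ℝ v (a i) ^ 2
    have hG0 : 0 ≤ G := Finset.sum_nonneg fun _ _ => sq_nonneg _
    have hCS : T ^ 2 ≤ (∑ i, x i ^ 2) * G := by
      rw [hTx]; exact Finset.sum_mul_sq_le_sq_mul_sq _ _ _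
    have hX : (1 - Fintype.card ι * ε) * ∑ i, x i ^ 2 ≤ T := by
      have h1 := (abs_le.1 (abs_norm_sum_smul_sq_sub_le ha hε haa x)).1
      have h2 : (∑ i, |x i|) ^ 2 ≤ Fintype.card ι * ∑ i, x i ^ 2 := by
        simpa using sq_sum_le_card_mul_sum_sq (s := Finset.univ) (f := fun i => |x i|)
      have h3 : T = ‖∑ i, x i • a i‖ ^ 2 := by rw [hx]; rfl
      have h4 := mul_le_mul_of_nonneg_left h2 hε
      rw [← h3] at h1
      linarith
    have key : (1 - Fintype.card ι * ε) * T ≤ G := by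
      rcases le_or_gt (1 - Fintype.card ι * ε) 0 with h | h
      · exact (mul_nonpos_of_nonpos_of_nonneg h hT0).trans hG0
      · rcases hT0.eq_or_lt with h0 | h0
        · rwa [← h0, mul_zero]
        · refine le_of_mul_le_mul_right ?_ h0
          calc (1 - Fintype.card ι * ε) * T * T = (1 - Fintype.card ι * ε) * T ^ 2 := by ring
            _ ≤ (1 - Fintype.card ι * ε) * ((∑ i, x i ^ 2) * G) := by gcongr
            _ = ((1 - Fintype.card ι * ε) * ∑ i, x i ^ 2) * G := by ring
            _ ≤ T * G := by gcongr
            _ = G * T := mul_comm _ _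
    have hT1 : T ≤ 1 := by nlinarith [sq_nonneg ‖v - S.starProjection v‖]
    have : Fintype.card ι * ε * T ≤ Fintype.card ι * ε := mul_le_of_le_one_right (by positivity) hT1
    linarith
  rw [abs_le]
  constructor
  · nlinarith [mul_nonneg hn0 hε]
  · nlinarith [mul_nonneg (sq_nonneg L) hε]

end Gram

/-! ### The Gram estimate in terms of the packing residual. -/

section Residual

lemma intrinsicResidual_nonneg {d : ℕ} {ι : Type*} (v : RepSpace d)
    (a : ι → RepSpace d) (γ : ι → ℝ) : 0 ≤ intrinsicResidual v a γ :=
  (Real.iSup_nonneg fun _ => abs_nonneg _).trans (le_max_left _ _)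

lemma abs_projSq_span_sub_irreducibleTax_le {d : ℕ} {ι : Type*} [Fintype ι] {v : RepSpace d}
    (hv : ‖v‖ = 1) {a : ι → RepSpace d} (ha : ∀ i, ‖a i‖ = 1) (γ : ι → ℝ)
    (h1 : intrinsicResidual v a γ ≤ 1) :
    |projSq v (Submodule.span ℝ (Set.range a)) - irreducibleTax γ| ≤
      (2 * ∑ i, |γ i| + (∑ i, |γ i|) ^ 2 + 2 * Fintype.card ι) * intrinsicResidual v a γ := by
  refine abs_projSq_span_sub_le hv ha (intrinsicResidual_nonneg v a γ) h1 (fun i => ?_)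
    fun i j hij => ?_
  · exact (le_ciSup (f := fun i => |packingResidual v (a i) (γ i)|)
      (Set.finite_range _).bddAbove i).trans (le_max_left _ _)
  · have h : |packingResidual (a i) (a j) 0| ≤ intrinsicResidual v a γ :=
      (le_ciSup (f := fun p : {p : ι × ι // p.1 ≠ p.2} =>
      |packingResidual (a p.1.1) (a p.1.2) 0|) (Set.finite_range _).bddAbove ⟨(i, j), hij⟩).trans
      (le_max_right (⨆ i, |packingResidual v (a i) (γ i)|) _)
    rwa [packingResidual, sub_zero] at h

end Residual

/-! ### Asymptotics in the dimension. -/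

section Scaling

lemma TendstoAtRateWHP.of_rate_le {Ω : ℕ → Type*} [∀ d, MeasurableSpace (Ω d)]
    {P : ∀ d, Measure (Ω d)} [∀ d, IsProbabilityMeasure (P d)] {X : ∀ d, Ω d → ℝ} {x : ℝ}
    {r s : ℕ → ℝ} (h : TendstoAtRateWHP P X x r) (hs : Tendsto s atTop (𝓝 0)) {C : ℝ}
    (hC : 0 < C) (hrs : ∀ᶠ d in atTop, r d ≤ C * s d) : TendstoAtRateWHP P X x s := by
  refine ⟨hs, fun A hA => ?_⟩
  obtain ⟨K, hK, hev⟩ := h.2 A hA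
  refine ⟨K * C, by positivity, ?_⟩
  filter_upwards [hev, hrs] with d h1 h2
  refine (measureReal_mono fun ω hω => ?_).trans h1
  simp only [Set.mem_ofPred_eq] at hω ⊢
  refine lt_of_le_of_lt ?_ hω
  rw [mul_assoc]
  gcongr

lemma tendsto_log_div_rpow_natCast {b : ℝ} (hb : 0 < b) :
    Tendsto (fun d : ℕ => Real.log d / (d : ℝ) ^ b) atTop (𝓝 0) :=
  (isLittleO_log_rpow_atTop hb).tendsto_div_nhds_zero.comp tendsto_natCast_atTop_atTop

lemma TendstoAtRateWHP.of_isBigO_residual {Ω : ℕ → Type*} [∀ d, MeasurableSpace (Ω d)]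
    {P : ∀ d, Measure (Ω d)} [∀ d, IsProbabilityMeasure (P d)] {X : ∀ d, Ω d → ℝ} {x : ℝ}
    {b : ℝ} (hb : 0 < b) {ε : ℕ → ℝ}
    (h : TendstoAtRateWHP P X x fun d => Real.log d / (d : ℝ) ^ b + ε d)
    (hε : ε =O[atTop] fun d : ℕ => Real.log d / (d : ℝ) ^ b) :
    TendstoAtRateWHP P X x fun d => Real.log d / (d : ℝ) ^ b := by
  obtain ⟨C, hC, hle⟩ := hε.exists_pos
  refine h.of_rate_le (tendsto_log_div_rpow_natCast hb) (C := 1 + C) (by positivity) ?_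
  filter_upwards [hle.bound, eventually_ge_atTop 1] with d h1 hd
  have h0 : 0 ≤ Real.log d / (d : ℝ) ^ b :=
    div_nonneg (Real.log_nonneg (by exact_mod_cast hd)) (by positivity)
  rw [Real.norm_eq_abs, Real.norm_eq_abs, abs_of_nonneg h0] at h1
  have := le_abs_self (ε d)
  linarith

variable {ι : Type*} [Fintype ι] {γ : ι → ℝ} {Ω : ℕ → Type*} [∀ d, MeasurableSpace (Ω d)]
  {P : ∀ d, Measure (Ω d)} [∀ d, IsProbabilityMeasure (P d)] {m' : ℕ → ℕ}
  {v : ∀ d, RepSpace d} {a : ∀ d, ι → RepSpace d} {c : ∀ d, Fin (m' d) → Ω d → RepSpace d}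

lemma tendstoAtRateWHP_packingTax_of_isBigO
    (hmodel : ∀ d, 1 ≤ d → IsRandomPacking (P d) (v d) (a d) (c d))
    (hγlim : Tendsto (fun d => intrinsicResidual (v d) (a d) γ) atTop (𝓝 0))
    {β : ℝ} (hβ : β < 1) (hm : (fun d => (m' d : ℝ)) =O[atTop] (fun d : ℕ => (d : ℝ) ^ β)) :
    TendstoAtRateWHP P (fun d => packingTax (v d) (a d) (c d)) (irreducibleTax γ)
      (fun d => Real.log d / (d : ℝ) ^ (1 - β) + intrinsicResidual (v d) (a d) γ) := by
  have hβ' : 0 < 1 - β := by linarith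
  have hlog := tendsto_log_div_rpow_natCast hβ'
  refine ⟨by simpa using hlog.add hγlim, fun A hA => ?_⟩
  obtain ⟨C, hC, hmC⟩ := hm.exists_pos
  set M := 2 * ∑ i, |γ i| + (∑ i, |γ i|) ^ 2 + 2 * (Fintype.card ι : ℝ)
  have hM : 0 ≤ M := by positivity
  -- With `r = B * (log d / d)` the tail `exp(-r d / 2)` equals `d^(-(A + 3))`. The three spare
  -- powers of `d` pay for the union bound: `m' ≤ d`, `card ι + m' + 1 ≤ 2 d`, and `4 ≤ d` for the
  -- constants.
  set B := 2 * (A + 3)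
  have hB : 0 < B := by positivity
  have hlog1 : Tendsto (fun d : ℕ => Real.log d / (d : ℝ)) atTop (𝓝 0) := by
    simpa using tendsto_log_div_rpow_natCast one_pos
  -- This yields the condition `N * r ≤ 1 / 2` with `N = card ι + m'`; it relies on `β < 1`.
  have hsmall : ∀ᶠ d : ℕ in atTop, Fintype.card ι * (B * (Real.log d / d)) +
      C * B * (Real.log d / (d : ℝ) ^ (1 - β)) < 1 / 2 := by
    refine Tendsto.eventually_lt_const (v := 0) (by norm_num) ?_
    simpa using ((hlog1.const_mul B).const_mul (Fintype.card ι : ℝ)).add (hlog.const_mul (C * B))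
  have hrsmall : ∀ᶠ d : ℕ in atTop, B * (Real.log d / d) < 1 / 2 := by
    refine Tendsto.eventually_lt_const (v := 0) (by norm_num) ?_
    simpa using hlog1.const_mul B
  have hmd : ∀ᶠ d : ℕ in atTop, C * (d : ℝ) ^ β ≤ d := by
    have h := ((tendsto_rpow_atTop hβ').comp tendsto_natCast_atTop_atTop).eventually_ge_atTop C
    filter_upwards [h, eventually_ge_atTop 1] with d h1 hd
    have hd0 : (0 : ℝ) < d := by exact_mod_cast hd
    calc C * (d : ℝ) ^ β ≤ (d : ℝ) ^ (1 - β) * (d : ℝ) ^ β := by gcongr; exact h1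
      _ = d := by rw [← Real.rpow_add hd0]; simp
  -- `2 * C * B` covers the random gain `m' * (2 * r)`, and `M` the deterministic error.
  refine ⟨2 * C * B + M, by positivity, ?_⟩
  filter_upwards [hmC.bound, hsmall, hrsmall, hmd, eventually_ge_atTop (Fintype.card ι + 1),
    eventually_ge_atTop 4, hγlim.eventually_le_const one_pos] with d hmC hsmall hrsmall hmd hdn hd4
    hε1
  have hd : 1 ≤ d := by omega
  have hd0 : (0 : ℝ) < d := by exact_mod_cast hd
  have hd1 : (1 : ℝ) ≤ d := by exact_mod_cast hd
  have hlog0 : 0 ≤ Real.log d := Real.log_nonneg hd1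
  set ε := intrinsicResidual (v d) (a d) γ
  have hε0 : 0 ≤ ε := intrinsicResidual_nonneg _ _ _
  set r := B * (Real.log d / d) with hr
  have hr0 : 0 ≤ r := by positivity
  rw [Real.norm_eq_abs, Real.norm_eq_abs, abs_of_nonneg (by positivity),
    abs_of_nonneg (by positivity)] at hmC
  have hpow : (d : ℝ) ^ β * (Real.log d / d) = Real.log d / (d : ℝ) ^ (1 - β) := by
    rw [Real.rpow_sub hd0, Real.rpow_one]; field_simp
  have hmr : m' d * r ≤ C * B * (Real.log d / (d : ℝ) ^ (1 - β)) := by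
    calc m' d * r ≤ C * (d : ℝ) ^ β * r := by gcongr
      _ = C * B * ((d : ℝ) ^ β * (Real.log d / d)) := by rw [hr]; ring
      _ = _ := by rw [hpow]
  have hmod := hmodel d hd
  have hdet := abs_projSq_span_sub_irreducibleTax_le hmod.norm_v hmod.norm_a γ hε1
  have hprob := hmod.measure_tax_gt_le hd hr0 hrsmall.le (by push_cast; linarith)
  refine (measureReal_mono fun ω hω => ?_).trans (hprob.trans ?_)
  · simp only [Set.mem_ofPred_eq] at hω ⊢
    have hS := projSq_mono (v d) (le_sup_left : Submodule.span ℝ (Set.range (a d)) ≤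
      Submodule.span ℝ (Set.range (a d)) ⊔ Submodule.span ℝ (Set.range fun j => c d j ω))
    rw [← packingTax_eq_projSq] at hS
    have h1 := abs_sub_le (packingTax (v d) (a d) (c d) ω)
      (projSq (v d) (Submodule.span ℝ (Set.range (a d)))) (irreducibleTax γ)
    rw [abs_of_nonneg (sub_nonneg.2 hS)] at h1
    have h2 : 0 ≤ M * (Real.log d / (d : ℝ) ^ (1 - β)) := by positivity
    have h3 : 0 ≤ 2 * C * B * ε := by positivity
    change |_| ≤ M * ε at hdet
    nlinarith
  · have hexp : Real.exp (-(r * d / 2)) = (d : ℝ) ^ (-(A + 3)) := by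
      rw [Real.rpow_def_of_pos hd0]
      congr 1
      rw [hr]; field_simp; ring
    have hm1 : (m' d : ℝ) ≤ d := hmC.trans hmd
    have hdn' : (Fintype.card ι : ℝ) + 1 ≤ d := by exact_mod_cast hdn
    have hd4' : (4 : ℝ) ≤ d := by exact_mod_cast hd4
    rw [hexp]
    have hp : (0 : ℝ) ≤ (d : ℝ) ^ (-(A + 3)) := by positivity
    calc m' d * ((Fintype.card ι + m' d + 1) * (2 * (d : ℝ) ^ (-(A + 3))))
        ≤ d * ((d + d) * (2 * (d : ℝ) ^ (-(A + 3)))) := by gcongr ?_ * (?_ * _); linarith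
      _ = 4 * (d : ℝ) ^ 2 * (d : ℝ) ^ (-(A + 3)) := by ring
      _ ≤ d * (d : ℝ) ^ 2 * (d : ℝ) ^ (-(A + 3)) := by gcongr
      _ = (d : ℝ) ^ (3 : ℝ) * (d : ℝ) ^ (-(A + 3)) := by
          rw [← pow_succ', ← Real.rpow_natCast]; norm_num
      _ = (d : ℝ) ^ (-A) := by rw [← Real.rpow_add hd0]; congr 1; ring

lemma exists_le_integral_packingTax_sub_le
    (hmodel : ∀ d, 1 ≤ d → IsRandomPacking (P d) (v d) (a d) (c d))
    (hγlim : Tendsto (fun d => intrinsicResidual (v d) (a d) γ) atTop (𝓝 0))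
    (hm : (fun d : ℕ => (d : ℝ)) =O[atTop] (fun d => (m' d : ℝ))) (hτ : irreducibleTax γ < 1) :
    ∃ k K : ℝ, 0 < k ∧ ∀ᶠ d in atTop,
      Integrable (packingTax (v d) (a d) (c d)) (P d) ∧
      k ≤ ∫ ω, (packingTax (v d) (a d) (c d) ω - irreducibleTax γ) ∂(P d) ∧
      ∫ ω, (packingTax (v d) (a d) (c d) ω - irreducibleTax γ) ∂(P d) ≤ K := by
  obtain ⟨C, hC, hmC⟩ := hm.exists_pos
  set M := 2 * ∑ i, |γ i| + (∑ i, |γ i|) ^ 2 + 2 * (Fintype.card ι : ℝ)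
  set q := Real.exp (-C⁻¹) with hq
  have hq1 : q < 1 := by rw [hq, Real.exp_lt_one_iff, neg_lt_zero]; exact inv_pos.2 hC
  have hq0 : 0 < q := Real.exp_pos _
  have hk : 0 < (1 - q) * (1 - irreducibleTax γ) / 2 :=
    half_pos (mul_pos (by linarith) (by linarith))
  have hτ0 : 0 ≤ irreducibleTax γ := Finset.sum_nonneg fun _ _ => sq_nonneg _
  have hsmall : ∀ᶠ d : ℕ in atTop, M * intrinsicResidual (v d) (a d) γ <
      (1 - q) * (1 - irreducibleTax γ) / 2 := by
    refine Tendsto.eventually_lt_const (v := 0) hk ?_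
    simpa using hγlim.const_mul M
  -- From `d ≤ C * m'` follows `(1 - 1/d)^m' ≤ exp(-m'/d) ≤ q`. If the intrinsic projection were
  -- exactly `τ₀`, the mean gain would be at least `(1 - q)(1 - τ₀)`; half of this is given up to
  -- absorb the residual. The upper constant `1` comes from `τ ≤ 1` and `τ₀ ≥ 0`.
  refine ⟨(1 - q) * (1 - irreducibleTax γ) / 2, 1, hk, ?_⟩
  filter_upwards [hmC.bound, hsmall, eventually_ge_atTop 1, hγlim.eventually_le_const one_pos]
    with d hmC hsmall hd hε1
  have hd0 : (0 : ℝ) < d := by exact_mod_cast hd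
  have hmod := hmodel d hd
  have hint := hmod.integrable_packingTax hd
  have hE := hmod.one_sub_le_integral_packingTax hd
  have hdet := abs_le.1 (abs_projSq_span_sub_irreducibleTax_le hmod.norm_v hmod.norm_a γ hε1)
  change -(M * _) ≤ _ ∧ _ ≤ M * _ at hdet
  rw [integral_sub hint (integrable_const _), integral_const, probReal_univ, one_smul]
  refine ⟨hint, ?_, ?_⟩
  · set T := projSq (v d) (Submodule.span ℝ (Set.range (a d)))
    have hT1 : T ≤ 1 := by simpa [hmod.norm_v] using projSq_le (v d) _
    rw [Real.norm_eq_abs, Real.norm_eq_abs, abs_of_nonneg hd0.le,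
      abs_of_nonneg (by positivity)] at hmC
    have hpow : (1 - 1 / (d : ℝ)) ^ m' d ≤ q := by
      have h0 : (0 : ℝ) ≤ 1 - 1 / d := by
        rw [sub_nonneg]; exact div_le_one_of_le₀ (by exact_mod_cast hd) hd0.le
      calc (1 - 1 / (d : ℝ)) ^ m' d ≤ Real.exp (-(1 / d)) ^ m' d := by
            gcongr; exact Real.one_sub_le_exp_neg _
        _ = Real.exp (m' d * -(1 / d)) := by rw [Real.exp_nat_mul]
        _ ≤ q := by
            rw [hq, Real.exp_le_exp, mul_neg, neg_le_neg_iff, mul_one_div, le_div_iff₀ hd0,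
              inv_mul_le_iff₀ hC]
            exact hmC
    have h1 := mul_le_mul_of_nonneg_right hpow (sub_nonneg.2 hT1)
    have h2 : q * (1 - T) ≤ q * (1 - irreducibleTax γ) +
        (1 - q) * (1 - irreducibleTax γ) / 2 := by
      nlinarith [hdet.1]
    linarith
  · have : ∫ ω, packingTax (v d) (a d) (c d) ω ∂P d ≤ ∫ _, (1 : ℝ) ∂P d :=
      integral_mono hint (integrable_const _) fun ω => packingTax_le_one hmod.norm_v _ _ ω
    rw [integral_const, probReal_univ, one_smul] at this
    linarith

end Scaling

theorem mainTheorem9 {ι : Type*} [Fintype ι] (γ : ι → ℝ) (hγ : ∀ i, γ i ≠ 0)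
    {Ω : ℕ → Type*} [∀ d, MeasurableSpace (Ω d)] (P : ∀ d, Measure (Ω d))
    [∀ d, IsProbabilityMeasure (P d)]
    (m' : ℕ → ℕ) (v : ∀ d, RepSpace d) (a : ∀ d, ι → RepSpace d) (c : ∀ d, Fin (m' d) → Ω d → RepSpace d)
    (hmodel : ∀ d, 1 ≤ d → IsRandomPacking (P d) (v d) (a d) (c d))
    (hγlim : Tendsto (fun d => intrinsicResidual (v d) (a d) γ) atTop (𝓝 0)) :
    -- fixed number of incidental capabilities
    (∀ m₀ : ℕ, (∀ᶠ d in atTop, m' d = m₀) →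
      TendstoAtRateWHP P (fun d => packingTax (v d) (a d) (c d)) (irreducibleTax γ)
        (fun d => Real.log d / d + intrinsicResidual (v d) (a d) γ) ∧
      ((fun d => intrinsicResidual (v d) (a d) γ) =O[atTop] (fun d : ℕ => Real.log d / d) →
        TendstoAtRateWHP P (fun d => packingTax (v d) (a d) (c d)) (irreducibleTax γ)
          (fun d => Real.log d / d))) ∧
    -- sublinear growth
    (∀ β : ℝ, β < 1 → (fun d => (m' d : ℝ)) =O[atTop] (fun d : ℕ => (d : ℝ) ^ β) →
      TendstoAtRateWHP P (fun d => packingTax (v d) (a d) (c d)) (irreducibleTax γ)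
        (fun d => Real.log d / (d : ℝ) ^ (1 - β) + intrinsicResidual (v d) (a d) γ) ∧
      ((fun d => intrinsicResidual (v d) (a d) γ) =O[atTop]
          (fun d : ℕ => Real.log d / (d : ℝ) ^ (1 - β)) →
        TendstoAtRateWHP P (fun d => packingTax (v d) (a d) (c d)) (irreducibleTax γ)
          (fun d => Real.log d / (d : ℝ) ^ (1 - β)))) ∧
    -- linear growth
    ((fun d => (m' d : ℝ)) =Θ[atTop] (fun d : ℕ => (d : ℝ)) → irreducibleTax γ < 1 →
      ∃ k K : ℝ, 0 < k ∧ ∀ᶠ d in atTop,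
        Integrable (packingTax (v d) (a d) (c d)) (P d) ∧
        k ≤ ∫ ω, (packingTax (v d) (a d) (c d) ω - irreducibleTax γ) ∂(P d) ∧
        ∫ ω, (packingTax (v d) (a d) (c d) ω - irreducibleTax γ) ∂(P d) ≤ K) := by
  have sub : ∀ β : ℝ, β < 1 → (fun d => (m' d : ℝ)) =O[atTop] (fun d : ℕ => (d : ℝ) ^ β) →
      TendstoAtRateWHP P (fun d => packingTax (v d) (a d) (c d)) (irreducibleTax γ)
        (fun d => Real.log d / (d : ℝ) ^ (1 - β) + intrinsicResidual (v d) (a d) γ) ∧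
      ((fun d => intrinsicResidual (v d) (a d) γ) =O[atTop]
          (fun d : ℕ => Real.log d / (d : ℝ) ^ (1 - β)) →
        TendstoAtRateWHP P (fun d => packingTax (v d) (a d) (c d)) (irreducibleTax γ)
          (fun d => Real.log d / (d : ℝ) ^ (1 - β))) := fun β hβ hm =>
    have h := tendstoAtRateWHP_packingTax_of_isBigO hmodel hγlim hβ hm
    ⟨h, fun hε => h.of_isBigO_residual (by linarith) hε⟩
  refine ⟨fun m₀ hm₀ => ?_, sub, fun hm hτ =>
    exists_le_integral_packingTax_sub_le hmodel hγlim hm.2 hτ⟩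
  -- A constant number of directions is the sublinear case with `β = 0`.
  have hm : (fun d => (m' d : ℝ)) =O[atTop] (fun d : ℕ => (d : ℝ) ^ (0 : ℝ)) := by
    refine IsBigO.of_bound m₀ ?_
    filter_upwards [hm₀] with d hd
    simp [hd]
  simpa only [sub_zero, Real.rpow_one] using sub 0 one_pos hm
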